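/- Let $A$ be a von Neumann algebra on a Hilbert space $H$ with a cyclic and separating vector $\Omega$ such that the (faithful normal) functional $\mu(a)=\langle\Omega,a\Omega\rangle$ is a trace on $A$, and let $\alpha$ be a $*$-automorphism of $A$ with $\mu\circ\alpha=\mu$. Write $\mathbf A=(A,\mu,\alpha)$. Let $U$ be the unitary operator on $H$ extending $a\Omega\mapsto\alpha(a)\Omega$ and let $J$ be the antiunitary operator on $H$ extending $a\Omega\mapsto a^*\Omega$. For a subsystem $\mathbf F$ of $\mathbf A$, i.e. a von Neumann subalgebra $F\subseteq A$ containing $1$ with $\alpha(F)=F$, together with the restrictions of $\mu$ and $\alpha$ to $F$, let $H_F=\overline{F\Omega}$, let $e_F$ be the orthogonal projection of $H$ onto $H_F$, and let $\langle A,e_F\rangle$ be the smallest von Neumann algebra on $H$ containing $A$ and $e_F$. Let $\bar\mu$ be the faithful semifinite normal tracial weight on $\langle A,e_F\rangle^+$ whose linear extension satisfies $\bar\mu(ae_Fb)=\mu(ab)$ for all $a,b\in A$; explicitly, $\bar\mu(x)=\sup\sum_{i=1}^n\langle\xi_i,x\xi_i\rangle$, the supremum being over all finite families $\xi_1,\dots,\xi_n\in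 H$ with $\bigl\|\sum_i Jf_i^*J\xi_i\bigr\|^2\le\sum_i\|f_i\Omega\|^2$ for all $f_1,\dots,f_n\in F$. A $U$-$\bar\mu$-module is a closed subspace $V\subseteq H\ominus H_F$ such that $UV=V$, $Jf^*JV\subseteq V$ for all $f\in F$, and $\bar\mu(P_V)<\infty$, where $P_V\in\langle A,e_F\rangle$ is the orthogonal projection onto $V$. The system $\mathbf A$ has discrete spectrum relative to $\mathbf F$ if the closed linear span of all $U$-$\bar\mu$-modules is $H\ominus H_F$. **Proposition.** Let $\mathbf F$ be the trivial subsystem, i.e. $F=\mathbb C1$. Then the weight $\bar\mu$ given by the formula above is the unique faithful semifinite normal tracial weight on $\langle A,e_F\rangle^+$ satisfying $\bar\mu(ae_Fb)=\mu(ab)$ for all $a,b\in A$, and $\mathbf A$ has discrete spectrum relative to $\mathbf F$ if and only if $\mathbf A$ has discrete spectrum, i.e. the closed linear span of the eigenvectors of $U$ is $H$. -/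

import Mathlib

open scoped ENNReal NNReal

noncomputable section

universe u

/-- The von Neumann algebra on `H` generated by a set `s` of operators: the smallest von Neumann
algebra containing `s`. -/
def VonNeumannAlgebra.generatedBy {H : Type u} [NormedAddCommGroup H] [InnerProductSpace ℂ H]
    [CompleteSpace H] (s : Set (H →L[ℂ] H)) : VonNeumannAlgebra H where
  carrier := {x | ∀ M : VonNeumannAlgebra H, s ⊆ (M : Set (H →L[ℂ] H)) → x ∈ M}
  mul_mem' hx hy M hM := mul_mem (hx M hM) (hy M hM)
  one_mem' M _ := one_mem M
  add_mem' hx hy M hM := add_mem (hx M hM) (hy M hM)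
  zero_mem' M _ := zero_mem M
  algebraMap_mem' c M _ := M.algebraMap_mem' c
  star_mem' hx M hM := star_mem (hx M hM)
  centralizer_centralizer' := by
    refine Set.Subset.antisymm (fun x hx M hM => ?_) (fun x hx y hy => (hy x hx).symm)
    have h1 : {x | ∀ N : VonNeumannAlgebra H, s ⊆ (N : Set (H →L[ℂ] H)) → x ∈ N}
        ⊆ (M : Set (H →L[ℂ] H)) := fun y hy => hy M hM
    have h2 := Set.centralizer_subset (Set.centralizer_subset h1) hx
    rw [M.centralizer_centralizer] at h2
    exact h2

/-- The trivial von Neumann algebra `ℂ1` on `H`. -/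
def VonNeumannAlgebra.scalars (H : Type u) [NormedAddCommGroup H] [InnerProductSpace ℂ H]
    [CompleteSpace H] : VonNeumannAlgebra H where
  toStarSubalgebra := ⊥
  centralizer_centralizer' := by
    have h : Set.centralizer ((⊥ : StarSubalgebra ℂ (H →L[ℂ] H)) : Set (H →L[ℂ] H))
        = Set.univ := by
      refine Set.eq_univ_of_forall fun x y hy => ?_
      obtain ⟨c, rfl⟩ := StarSubalgebra.mem_bot.mp hy
      exact Algebra.commutes c x
    change Set.centralizer (Set.centralizer
      ((⊥ : StarSubalgebra ℂ (H →L[ℂ] H)) : Set (H →L[ℂ] H))) = _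
    rw [h, Set.centralizer_univ]
    ext x
    constructor
    · intro hx
      have hx' : x ∈ Subalgebra.center ℂ (H →L[ℂ] H) := hx
      rw [Algebra.IsCentral.center_eq_bot] at hx'
      obtain ⟨c, hc⟩ := Algebra.mem_bot.mp hx'
      exact StarSubalgebra.mem_bot.mpr ⟨c, hc⟩
    · intro hx
      obtain ⟨c, rfl⟩ := StarSubalgebra.mem_bot.mp hx
      exact Subalgebra.algebraMap_mem (Subalgebra.center ℂ (H →L[ℂ] H)) c

/-- A (tracial) W*-dynamical system in standard form: a von Neumann algebra `A` on `H` with a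
cyclic and separating vector `Ω` such that the (automatically normal, and faithful as `Ω` is
separating) functional `μ(a) = ⟪Ω, a Ω⟫` is a trace, and a `*`-automorphism `α` of `A` with
`μ ∘ α = μ`. -/
structure WStarSystem (H : Type u) [NormedAddCommGroup H] [InnerProductSpace ℂ H]
    [CompleteSpace H] where
  /-- the von Neumann algebra `A` -/
  alg : VonNeumannAlgebra H
  /-- the vector `Ω` -/
  Ω : H
  cyclic : Dense {x : H | ∃ a ∈ alg, a Ω = x}
  separating : ∀ a ∈ alg, a Ω = 0 → a = 0
  tracial : ∀ a ∈ alg, ∀ b ∈ alg, inner ℂ Ω ((a * b) Ω) = inner ℂ Ω ((b * a) Ω)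
  /-- the `*`-automorphism `α` of `A` -/
  α : alg.toStarSubalgebra ≃⋆ₐ[ℂ] alg.toStarSubalgebra
  invariant : ∀ a : alg.toStarSubalgebra,
    inner ℂ Ω ((α a : H →L[ℂ] H) Ω) = inner ℂ Ω ((a : H →L[ℂ] H) Ω)

namespace WStarSystem

variable {H : Type u} [NormedAddCommGroup H] [InnerProductSpace ℂ H] [CompleteSpace H]

/-- The map `A → H`, `a ↦ a Ω`. -/
def toH (S : WStarSystem H) : S.alg.toStarSubalgebra →ₗ[ℂ] H where
  toFun a := (a : H →L[ℂ] H) S.Ω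
  map_add' _ _ := rfl
  map_smul' _ _ := rfl

theorem denseRange_toH (S : WStarSystem H) : DenseRange S.toH := by
  refine S.cyclic.mono ?_
  rintro x ⟨a, ha, rfl⟩
  exact ⟨⟨a, ha⟩, rfl⟩

theorem norm_sq_toH (S : WStarSystem H) (a : S.alg.toStarSubalgebra) :
    ((‖S.toH a‖ : ℂ)) ^ 2 = inner ℂ S.Ω (((star a * a : S.alg.toStarSubalgebra) :
      H →L[ℂ] H) S.Ω) := by
  have h : ((star a * a : S.alg.toStarSubalgebra) : H →L[ℂ] H) S.Ω
      = ContinuousLinearMap.adjoint (a : H →L[ℂ] H) ((a : H →L[ℂ] H) S.Ω) := rfl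
  rw [h, ContinuousLinearMap.adjoint_inner_right]
  exact (inner_self_eq_norm_sq_to_K (𝕜 := ℂ) (S.toH a)).symm

theorem norm_toH_eq (S : WStarSystem H) {a b : S.alg.toStarSubalgebra}
    (h : inner ℂ S.Ω (((star a * a : S.alg.toStarSubalgebra) : H →L[ℂ] H) S.Ω)
      = inner ℂ S.Ω (((star b * b : S.alg.toStarSubalgebra) : H →L[ℂ] H) S.Ω)) :
    ‖S.toH a‖ = ‖S.toH b‖ := by
  rw [← norm_sq_toH, ← norm_sq_toH] at h
  have h' : ‖S.toH a‖ ^ 2 = ‖S.toH b‖ ^ 2 := by exact_mod_cast h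
  exact (pow_left_inj₀ (norm_nonneg _) (norm_nonneg _) two_ne_zero).mp h'

/-- The unitary `U` on `H` representing the dynamics: the extension of `a Ω ↦ α(a) Ω`. -/
def U (S : WStarSystem H) : H ≃ₗᵢ[ℂ] H :=
  S.α.toAlgEquiv.toLinearEquiv.extendOfIsometry S.toH S.toH S.denseRange_toH S.denseRange_toH
    (fun a => S.norm_toH_eq (by
      have h := S.invariant (star a * a)
      rw [map_mul, map_star] at h
      exact h))

theorem U_apply (S : WStarSystem H) (a : S.alg.toStarSubalgebra) :
    S.U ((a : H →L[ℂ] H) S.Ω) = (S.α a : H →L[ℂ] H) S.Ω :=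
  LinearEquiv.extendOfIsometry_eq (f := S.α.toAlgEquiv.toLinearEquiv) (e₁ := S.toH)
    (e₂ := S.toH) S.denseRange_toH S.denseRange_toH _ a

/-- The modular conjugation `J` of the trace: the antiunitary extension of `a Ω ↦ a* Ω`. -/
def J (S : WStarSystem H) : H ≃ₗᵢ⋆[ℂ] H :=
  (starLinearEquiv ℂ (A := S.alg.toStarSubalgebra)).extendOfIsometry S.toH S.toH
    S.denseRange_toH S.denseRange_toH (fun a => S.norm_toH_eq (by
      have h := S.tracial a a.2 (star a : S.alg.toStarSubalgebra)
        (star a : S.alg.toStarSubalgebra).2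
      change inner ℂ S.Ω (((star (star a) * star a : S.alg.toStarSubalgebra) :
        H →L[ℂ] H) S.Ω) = _
      rw [star_star]
      exact h))

theorem J_apply (S : WStarSystem H) (a : S.alg.toStarSubalgebra) :
    S.J ((a : H →L[ℂ] H) S.Ω) = (star (a : H →L[ℂ] H)) S.Ω :=
  LinearEquiv.extendOfIsometry_eq (f := starLinearEquiv ℂ (A := S.alg.toStarSubalgebra))
    (e₁ := S.toH) (e₂ := S.toH) S.denseRange_toH S.denseRange_toH _ a

/-- The right action `x a := j(a) x = J a* J x` of operators on `H`. -/
def rmul (S : WStarSystem H) (x : H) (a : H →L[ℂ] H) : H := S.J ((star a) (S.J x))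

/-- The system has discrete spectrum: the eigenvectors of `U` span a dense subspace of `H`. -/
def HasDiscreteSpectrum (S : WStarSystem H) : Prop :=
  (Submodule.span ℂ {x : H | x ≠ 0 ∧ ∃ c : ℂ, S.U x = c • x}).closure = ⊤

/-- A subsystem: a (unital) von Neumann subalgebra `F` of `A` such that `α` restricts to an
automorphism of `F`. Its trace and its dynamics are the restrictions of `μ` and `α`. -/
structure Subsystem (S : WStarSystem H) where
  /-- the von Neumann subalgebra `F` -/
  alg : VonNeumannAlgebra H
  le : alg ≤ S.alg
  mem_iff : ∀ a : S.alg.toStarSubalgebra,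
    (S.α a : H →L[ℂ] H) ∈ alg ↔ (a : H →L[ℂ] H) ∈ alg

/-- The trivial subsystem `F = ℂ1`. -/
def trivialSubsystem (S : WStarSystem H) : S.Subsystem where
  alg := VonNeumannAlgebra.scalars H
  le := by
    intro x hx
    obtain ⟨c, rfl⟩ := StarSubalgebra.mem_bot.mp hx
    exact S.alg.algebraMap_mem' c
  mem_iff := by
    intro a
    have key : ∀ (β : S.alg.toStarSubalgebra ≃⋆ₐ[ℂ] S.alg.toStarSubalgebra)
        (b : S.alg.toStarSubalgebra), (b : H →L[ℂ] H) ∈ VonNeumannAlgebra.scalars H →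
        (β b : H →L[ℂ] H) ∈ VonNeumannAlgebra.scalars H := by
      intro β b hb
      obtain ⟨c, hc⟩ := StarSubalgebra.mem_bot.mp hb
      have hb' : b = algebraMap ℂ _ c := Subtype.ext hc.symm
      refine StarSubalgebra.mem_bot.mpr ⟨c, ?_⟩
      have h2 : β b = algebraMap ℂ _ c := by
        rw [hb', Algebra.algebraMap_eq_smul_one, map_smul, map_one]
      rw [h2]
      rfl
    refine ⟨fun h => ?_, key S.α a⟩
    have := key S.α.symm _ h
    rwa [StarAlgEquiv.symm_apply_apply] at this

namespace Subsystem

variable {S : WStarSystem H}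

/-- `H_F`, the closure of `F Ω`. -/
def HF (F : S.Subsystem) : ClosedSubmodule ℂ H :=
  (Submodule.span ℂ {x : H | ∃ f ∈ F.alg, f S.Ω = x}).closure

/-- `e_F`, the orthogonal projection of `H` onto `H_F`. -/
def e (F : S.Subsystem) : H →L[ℂ] H := F.HF.toSubmodule.starProjection

/-- The basic construction `⟨A, e_F⟩`. -/
def basicConstruction (F : S.Subsystem) : VonNeumannAlgebra H :=
  VonNeumannAlgebra.generatedBy ((S.alg : Set (H →L[ℂ] H)) ∪ {F.e})

/-- The positive part `⟨A, e_F⟩⁺` of the basic construction, with the usual operator order. -/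
abbrev basicPos (F : S.Subsystem) : Type u :=
  {x : H →L[ℂ] H // x ∈ F.basicConstruction ∧ 0 ≤ x}

/-- `F`-contractive finite families `ξ₁, …, ξₙ` in `H`: the map
`(f₁ Ω, …, fₙ Ω) ↦ ∑ ξᵢ fᵢ` from `(F Ω)ⁿ` to `H` is a contraction. Equivalently, each `ξᵢ` is
right `F`-bounded and the operators `Lᵢ : f Ω ↦ ξᵢ f` on `H_F` satisfy `∑ Lᵢ Lᵢ* ≤ 1`. -/
def IsContractiveFamily (F : S.Subsystem) {n : ℕ} (ξ : Fin n → H) : Prop :=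
  ∀ f : Fin n → H →L[ℂ] H, (∀ i, f i ∈ F.alg) →
    ‖∑ i, S.rmul (ξ i) (f i)‖ ^ 2 ≤ ∑ i, ‖f i S.Ω‖ ^ 2

/-- The trace `μ̄` on `⟨A, e_F⟩⁺`. Since `μ̄(L L*) = ‖ξ‖²` for a right `F`-bounded vector `ξ` with
operator `L : f Ω ↦ ξ f`, and since `1` is the supremum of the sums `∑ Lᵢ Lᵢ* ≤ 1`, normality
gives `μ̄(x) = sup ∑ ⟪ξᵢ, x ξᵢ⟫` over all `F`-contractive finite families. The properties that
determine `μ̄` are collected in `IsBasicTrace` below. -/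
def basicTrace (F : S.Subsystem) (x : F.basicPos) : ℝ≥0∞ :=
  ⨆ (n : ℕ) (ξ : Fin n → H) (_ : F.IsContractiveFamily ξ),
    ∑ i, ENNReal.ofReal (inner ℂ (ξ i) (x.1 (ξ i))).re

/-- `τ` is a faithful semifinite normal tracial weight on `⟨A, e_F⟩⁺` such that
`τ(a* e_F a) = μ(a* a)` for all `a ∈ A`; by polarization the last condition says that the linear
extension of `τ` satisfies `τ(a e_F b) = μ(a b)` for all `a, b ∈ A`. -/
structure IsBasicTrace (F : S.Subsystem) (τ : F.basicPos → ℝ≥0∞) : Prop where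
  add : ∀ x y z : F.basicPos, z.1 = x.1 + y.1 → τ z = τ x + τ y
  smul : ∀ (c : ℝ≥0) (x y : F.basicPos), y.1 = (c : ℝ) • x.1 → τ y = c * τ x
  tracial : ∀ (t : H →L[ℂ] H), t ∈ F.basicConstruction → ∀ x y : F.basicPos,
    x.1 = star t * t → y.1 = t * star t → τ x = τ y
  faithful : ∀ x : F.basicPos, τ x = 0 → x.1 = 0
  normal : ∀ (D : Set F.basicPos) (x : F.basicPos), D.Nonempty → DirectedOn (· ≤ ·) D →
    IsLUB D x → τ x = ⨆ d ∈ D, τ d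
  semifinite : ∀ x : F.basicPos, x.1 ≠ 0 → ∃ y : F.basicPos, y ≤ x ∧ y.1 ≠ 0 ∧ τ y < ∞
  apply_e : ∀ a ∈ S.alg, ∀ x : F.basicPos, x.1 = star a * F.e * a →
    τ x = ENNReal.ofReal (inner ℂ S.Ω ((star a * a) S.Ω)).re

/-- A closed subspace `V` is a right `F`-submodule if `V F ⊆ V`. -/
def IsRightSubmodule (F : S.Subsystem) (V : ClosedSubmodule ℂ H) : Prop :=
  ∀ x ∈ V, ∀ f ∈ F.alg, S.rmul x f ∈ V

/-- `V` is a `U`-`μ̄`-module: a closed right `F`-submodule of `H ⊖ H_F` with `U V = V` and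
`μ̄(P_V) < ∞`, where `P_V`, the projection onto `V`, lies in `⟨A, e_F⟩⁺`. -/
structure IsUModule (F : S.Subsystem) (V : ClosedSubmodule ℂ H) : Prop where
  le_orthogonal : V ≤ F.HFᗮ
  map_eq : S.U '' (V : Set H) = (V : Set H)
  right : F.IsRightSubmodule V
  finite : ∃ h : V.toSubmodule.starProjection ∈ F.basicConstruction ∧
      0 ≤ V.toSubmodule.starProjection, F.basicTrace ⟨V.toSubmodule.starProjection, h⟩ < ∞

/-- `ℰ_{A/F}`, the closed subspace of `H ⊖ H_F` spanned by all `U`-`μ̄`-modules. -/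
def moduleSpan (F : S.Subsystem) : ClosedSubmodule ℂ H :=
  (Submodule.span ℂ {x : H | ∃ V : ClosedSubmodule ℂ H, F.IsUModule V ∧ x ∈ V}).closure

end Subsystem

/-- The system has discrete spectrum relative to `F`: `ℰ_{A/F} = H ⊖ H_F`. -/
def HasDiscreteSpectrumRel (S : WStarSystem H) (F : S.Subsystem) : Prop :=
  F.moduleSpan = F.HFᗮ

end WStarSystem

end

/-! Over `ℂ1` the basic construction is all of `B(H)`: an operator commuting with `e_F` sends `Ω` to
a multiple of `Ω`, and if it also commutes with `A`, cyclicity makes it a scalar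
(`mem_trivialSubsystem_basicConstruction`). The weight given by the formula is then `‖Ω‖²` times the
usual trace (`basicTrace_eq_opTrace`), and it inherits the required properties from that trace.

For uniqueness, traciality carries the value at `e_F` to every rank-one positive operator
(`apply_rankOne`), and normality carries it on to every `t* t`, the supremum of finite sums of
rank-one operators (`eq_basicTrace`).

For spectra, a projection of finite weight has finite rank, so a module is a finite-dimensional
`U`-invariant subspace and is spanned by eigenvectors. Conversely, an eigenvector orthogonal to `Ω`
spans a one-dimensional module. The remaining direction `ℂΩ` is itself fixed by `U`, so the two
notions agree. -/

section OperatorTrace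

open InnerProductSpace

variable {H : Type*} [NormedAddCommGroup H] [InnerProductSpace ℂ H]

/-! ### The trace of positive operators in a Hilbert basis. -/

theorem re_inner_nonneg_of_nonneg {x : H →L[ℂ] H} (hx : 0 ≤ x) (v : H) :
    0 ≤ (inner ℂ v (x v)).re :=
  ((ContinuousLinearMap.nonneg_iff_isPositive x).mp hx).re_inner_nonneg_right v

theorem rankOne_self_nonneg (v : H) : 0 ≤ rankOne ℂ v v :=
  (ContinuousLinearMap.nonneg_iff_isPositive _).mpr (isPositive_rankOne_self v)

theorem HilbertBasis.hasSum_norm_inner_sq {ι : Type*} (b : HilbertBasis ι ℂ H) (v : H) :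
    HasSum (fun i => ‖inner ℂ (b i) v‖ ^ 2) (‖v‖ ^ 2) := by
  have h := (b.hasSum_inner_mul_inner v v).mapL Complex.reCLM
  have h1 : ∀ i, Complex.reCLM (inner ℂ v (b i) * inner ℂ (b i) v) = ‖inner ℂ (b i) v‖ ^ 2 := by
    intro i
    rw [← inner_conj_symm v (b i), Complex.conj_mul']
    simp [← Complex.ofReal_pow]
  have h2 : Complex.reCLM (inner ℂ v v) = ‖v‖ ^ 2 := inner_self_eq_norm_sq (𝕜 := ℂ) v
  simpa only [h1, h2] using h

theorem HilbertBasis.tsum_enorm_inner_sq {ι : Type*} (b : HilbertBasis ι ℂ H) (v : H) :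
    ∑' i, ‖inner ℂ (b i) v‖ₑ ^ 2 = ‖v‖ₑ ^ 2 := by
  have h := b.hasSum_norm_inner_sq v
  have h3 := ENNReal.ofReal_tsum_of_nonneg (fun i => sq_nonneg ‖inner ℂ (b i) v‖) h.summable
  rw [h.tsum_eq] at h3
  simpa [ENNReal.ofReal_pow, ofReal_norm] using h3.symm

theorem starProjection_congr {K L : Submodule ℂ H} [K.HasOrthogonalProjection]
    [L.HasOrthogonalProjection] (h : K = L) : K.starProjection = L.starProjection := by
  subst h
  rfl

theorem starProjection_span_singleton_eq_rankOne (v : H) :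
    (ℂ ∙ v).starProjection = rankOne ℂ ((‖v‖⁻¹ : ℂ) • v) ((‖v‖⁻¹ : ℂ) • v) := by
  ext x
  rw [Submodule.starProjection_singleton, rankOne_apply, inner_smul_left, smul_smul]
  congr 1
  simp
  ring

/-- The trace of a positive operator with respect to a Hilbert basis. -/
noncomputable def HilbertBasis.opTrace {ι : Type*} (b : HilbertBasis ι ℂ H) (x : H →L[ℂ] H) :
    ℝ≥0∞ :=
  ∑' i, ENNReal.ofReal (inner ℂ (b i) (x (b i))).re

variable {ι : Type*} (b : HilbertBasis ι ℂ H)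

theorem HilbertBasis.opTrace_rankOne (v : H) : b.opTrace (rankOne ℂ v v) = ‖v‖ₑ ^ 2 := by
  rw [← b.tsum_enorm_inner_sq]
  refine tsum_congr fun i => ?_
  rw [inner_right_rankOne_apply, ← inner_conj_symm v (b i), Complex.mul_conj']
  rw [← Complex.ofReal_pow, Complex.ofReal_re, ENNReal.ofReal_pow (norm_nonneg _), ofReal_norm]

theorem HilbertBasis.opTrace_add {x y : H →L[ℂ] H} (hx : 0 ≤ x) (hy : 0 ≤ y) :
    b.opTrace (x + y) = b.opTrace x + b.opTrace y := by
  rw [opTrace, opTrace, opTrace, ← ENNReal.tsum_add]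
  refine tsum_congr fun i => ?_
  rw [← ENNReal.ofReal_add (re_inner_nonneg_of_nonneg hx _) (re_inner_nonneg_of_nonneg hy _)]
  simp

theorem HilbertBasis.opTrace_smul (c : ℝ≥0) (x : H →L[ℂ] H) :
    b.opTrace ((c : ℝ) • x) = c * b.opTrace x := by
  rw [opTrace, opTrace, ← ENNReal.tsum_mul_left]
  refine tsum_congr fun i => ?_
  have h : (inner ℂ (b i) (((c : ℝ) • x) (b i))).re = c * (inner ℂ (b i) (x (b i))).re := by
    rw [smul_apply, ← Complex.coe_smul, inner_smul_right]
    simp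
  rw [h, ENNReal.ofReal_mul c.coe_nonneg, ENNReal.ofReal_coe_nnreal]

variable [CompleteSpace H]

theorem re_inner_star_mul_self (s : H →L[ℂ] H) (v : H) :
    (inner ℂ v ((star s * s) v)).re = ‖s v‖ ^ 2 := by
  have h : inner ℂ v ((star s * s) v) = inner ℂ (s v) (s v) :=
    ContinuousLinearMap.adjoint_inner_right s v (s v)
  rw [h]
  exact inner_self_eq_norm_sq (𝕜 := ℂ) (s v)

theorem ofReal_re_inner_star_mul_self (s : H →L[ℂ] H) (v : H) :
    ENNReal.ofReal (inner ℂ v ((star s * s) v)).re = ‖s v‖ₑ ^ 2 := by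
  rw [re_inner_star_mul_self, ENNReal.ofReal_pow (norm_nonneg _), ofReal_norm]

theorem HilbertBasis.opTrace_star_mul_self (t : H →L[ℂ] H) :
    b.opTrace (star t * t) = ∑' i, ‖t (b i)‖ₑ ^ 2 :=
  tsum_congr fun i => ofReal_re_inner_star_mul_self t (b i)

/-- Parseval expands both sides into double sums of squared matrix coefficients, which Tonelli
interchanges. -/
theorem HilbertBasis.tsum_enorm_star_apply_sq (t : H →L[ℂ] H) :
    ∑' i, ‖(star t) (b i)‖ₑ ^ 2 = ∑' i, ‖t (b i)‖ₑ ^ 2 := by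
  simp_rw [← b.tsum_enorm_inner_sq]
  rw [ENNReal.tsum_comm]
  refine tsum_congr fun i => tsum_congr fun j => ?_
  have h : inner ℂ (b i) ((star t) (b j)) = inner ℂ (t (b i)) (b j) :=
    ContinuousLinearMap.adjoint_inner_right t (b i) (b j)
  rw [h, ← inner_conj_symm, RCLike.enorm_conj]

theorem HilbertBasis.opTrace_mul_comm_star (t : H →L[ℂ] H) :
    b.opTrace (star t * t) = b.opTrace (t * star t) := by
  have h := b.opTrace_star_mul_self (star t)
  rw [star_star] at h
  rw [h, b.opTrace_star_mul_self, b.tsum_enorm_star_apply_sq]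

theorem exists_eq_star_mul_self {x : H →L[ℂ] H} (hx : 0 ≤ x) : ∃ s : H →L[ℂ] H, x = star s * s :=
  CStarAlgebra.nonneg_iff_eq_star_mul_self.mp hx

theorem re_inner_le_of_le {x y : H →L[ℂ] H} (h : x ≤ y) (v : H) :
    (inner ℂ v (x v)).re ≤ (inner ℂ v (y v)).re := by
  have := re_inner_nonneg_of_nonneg (sub_nonneg.mpr h) v
  simpa [inner_sub_right] using this

theorem le_of_re_inner_le {x y : H →L[ℂ] H} (hx : IsSelfAdjoint x) (hy : IsSelfAdjoint y)
    (h : ∀ v, (inner ℂ v (x v)).re ≤ (inner ℂ v (y v)).re) : x ≤ y := by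
  rw [ContinuousLinearMap.le_def, ContinuousLinearMap.isPositive_def']
  refine ⟨hy.sub hx, fun v => ?_⟩
  rw [ContinuousLinearMap.reApplyInnerSelf_apply, inner_re_symm]
  simpa [inner_sub_right] using h v

theorem HilbertBasis.eq_zero_of_opTrace_eq_zero {x : H →L[ℂ] H} (hx : 0 ≤ x)
    (h : b.opTrace x = 0) : x = 0 := by
  obtain ⟨s, rfl⟩ := exists_eq_star_mul_self hx
  rw [b.opTrace_star_mul_self, ENNReal.tsum_eq_zero] at h
  have hs : s = 0 := by
    refine ContinuousLinearMap.ext_on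
      (Submodule.dense_iff_topologicalClosure_eq_top.mpr b.dense_span) ?_
    rintro _ ⟨i, rfl⟩
    simpa using h i
  simp [hs]

/-! ### Monotone nets and normality of the trace. -/

/-- A monotone bounded net of positive operators converges weakly. -/
theorem exists_weak_limit_of_monotone {κ : Type*} [Preorder κ] [IsDirectedOrder κ] [Nonempty κ]
    {f : κ → H →L[ℂ] H} (hf : Monotone f) (h0 : ∀ k, 0 ≤ f k) {x : H →L[ℂ] H}
    (hx : ∀ k, f k ≤ x) :
    ∃ y : H →L[ℂ] H, ∀ v w : H,
      Filter.Tendsto (fun k => inner ℂ (f k v) w) Filter.atTop (nhds (inner ℂ (y v) w)) := by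
  have hdiag : ∀ v : H, ∃ l : ℂ,
      Filter.Tendsto (fun k => inner ℂ (f k v) v) Filter.atTop (nhds l) := by
    intro v
    have hre : ∀ k, inner ℂ (f k v) v = (((inner ℂ v (f k v)).re : ℝ) : ℂ) := by
      intro k
      have h1 := (ContinuousLinearMap.isPositive_iff_complex (f k)).mp
        ((ContinuousLinearMap.nonneg_iff_isPositive _).mp (h0 k)) v
      rw [← h1.1, inner_re_symm]
      rfl
    refine ⟨((⨆ k, (inner ℂ v (f k v)).re : ℝ) : ℂ), ?_⟩
    simp_rw [hre]
    refine (Complex.continuous_ofReal.tendsto _).comp ?_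
    refine tendsto_atTop_ciSup (fun k l hkl => re_inner_le_of_le (hf hkl) v) ?_
    refine ⟨(inner ℂ v (x v)).re, ?_⟩
    rintro _ ⟨k, rfl⟩
    exact re_inner_le_of_le (hx k) v
  have hlim : ∀ v w : H, ∃ l : ℂ,
      Filter.Tendsto (fun k => inner ℂ (f k v) w) Filter.atTop (nhds l) := by
    intro v w
    obtain ⟨l1, h1⟩ := hdiag (w + v)
    obtain ⟨l2, h2⟩ := hdiag (w - v)
    obtain ⟨l3, h3⟩ := hdiag (w + Complex.I • v)
    obtain ⟨l4, h4⟩ := hdiag (w - Complex.I • v)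
    -- Polarization reduces the sesquilinear limit to four diagonal ones, which exist by monotone
    -- convergence.
    have hp := fun k => inner_map_polarization (f k : H →ₗ[ℂ] H) w v
    simp only [ContinuousLinearMap.coe_coe] at hp
    simp_rw [hp]
    exact ⟨_, ((((h1.sub h2).add (h3.const_mul _)).sub (h4.const_mul _)).div_const _)⟩
  choose B hB using hlim
  -- From `0 ≤ f k ≤ x` follows `‖f k‖ ≤ ‖x‖`, so the limit form is bounded and represented by an
  -- operator.
  have hBn : ∀ v w, ‖B v w‖ ≤ ‖x‖ * ‖v‖ * ‖w‖ := by
    intro v w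
    refine le_of_tendsto (hB v w).norm (Filter.Eventually.of_forall fun k => ?_)
    refine (norm_inner_le_norm _ _).trans ?_
    gcongr
    refine (f k).le_of_opNorm_le ?_ v
    exact CStarAlgebra.norm_le_norm_of_nonneg_of_le (h0 k) (hx k)
  let L : H →L⋆[ℂ] H →L[ℂ] ℂ := LinearMap.mkContinuous₂
    (LinearMap.mk₂'ₛₗ (starRingEnd ℂ) (RingHom.id ℂ) B
      (fun v v' w => tendsto_nhds_unique (hB (v + v') w) (by
        simpa [inner_add_left] using (hB v w).add (hB v' w)))
      (fun c v w => tendsto_nhds_unique (hB (c • v) w) (by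
        simpa [inner_smul_left, mul_comm] using (hB v w).const_mul (starRingEnd ℂ c)))
      (fun v w w' => tendsto_nhds_unique (hB v (w + w')) (by
        simpa [inner_add_right] using (hB v w).add (hB v w')))
      (fun c v w => tendsto_nhds_unique (hB v (c • w)) (by
        simpa [inner_smul_right] using (hB v w).const_mul c))) ‖x‖ hBn
  refine ⟨InnerProductSpace.continuousLinearMapOfBilin L, fun v w => ?_⟩
  rw [InnerProductSpace.continuousLinearMapOfBilin_apply]
  exact hB v w

/-- The quadratic form of a least upper bound of a monotone net of positive operators is the
supremum of the quadratic forms. -/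
theorem ofReal_re_inner_isLUB {κ : Type*} [Preorder κ] [IsDirectedOrder κ] [Nonempty κ]
    {f : κ → H →L[ℂ] H} (hf : Monotone f) (h0 : ∀ k, 0 ≤ f k) {x : H →L[ℂ] H}
    (hx : ∀ k, f k ≤ x) (hlub : ∀ y, 0 ≤ y → (∀ k, f k ≤ y) → x ≤ y) (v : H) :
    ENNReal.ofReal (inner ℂ v (x v)).re = ⨆ k, ENNReal.ofReal (inner ℂ v (f k v)).re := by
  obtain ⟨y, hy⟩ := exists_weak_limit_of_monotone hf h0 hx
  have hre : ∀ v : H, Filter.Tendsto (fun k => (inner ℂ v (f k v)).re) Filter.atTop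
      (nhds (inner ℂ v (y v)).re) := by
    intro v
    have h1 := (Complex.continuous_re.tendsto _).comp (hy v v)
    have h2 : ∀ z : H →L[ℂ] H, (inner ℂ (z v) v).re = (inner ℂ v (z v)).re :=
      fun z => inner_re_symm (𝕜 := ℂ) _ _
    simpa only [Function.comp_def, h2] using h1
  have hmono : ∀ v : H, Monotone fun k => (inner ℂ v (f k v)).re :=
    fun v k l hkl => re_inner_le_of_le (hf hkl) v
  have hys : IsSelfAdjoint y := by
    rw [ContinuousLinearMap.isSelfAdjoint_iff_isSymmetric]
    intro v w
    refine tendsto_nhds_unique (hy v w) ?_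
    have h1 := (Complex.continuous_conj.tendsto _).comp (hy w v)
    simp only [Function.comp_def, inner_conj_symm] at h1
    refine h1.congr fun k => ?_
    exact (((ContinuousLinearMap.nonneg_iff_isPositive _).mp
      (h0 k)).inner_left_eq_inner_right v w).symm
  have hfy : ∀ k, f k ≤ y := fun k => le_of_re_inner_le (IsSelfAdjoint.of_nonneg (h0 k)) hys
    fun v => (hmono v).ge_of_tendsto (hre v) k
  have hy0 : 0 ≤ y := (h0 (Classical.arbitrary κ)).trans (hfy _)
  refine le_antisymm ?_ (iSup_le fun k => ENNReal.ofReal_le_ofReal (re_inner_le_of_le (hx k) v))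
  -- The weak limit `y` is an upper bound, so `x ≤ y`, while the form of `y` is a limit of forms
  -- below the supremum.
  refine (ENNReal.ofReal_le_ofReal (re_inner_le_of_le (hlub y hy0 hfy) v)).trans ?_
  refine le_of_tendsto ((ENNReal.continuous_ofReal.tendsto _).comp (hre v))
    (Filter.Eventually.of_forall fun k => ?_)
  exact le_iSup (fun k => ENNReal.ofReal (inner ℂ v (f k v)).re) k

/-- The trace is a supremum of finite sums of quadratic forms; each form is normal, and suprema
commute with one another and with finite sums of monotone nets. -/
theorem HilbertBasis.opTrace_isLUB {κ : Type*} [Preorder κ] [IsDirectedOrder κ] [Nonempty κ]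
    {f : κ → H →L[ℂ] H} (hf : Monotone f) (h0 : ∀ k, 0 ≤ f k) {x : H →L[ℂ] H}
    (hx : ∀ k, f k ≤ x) (hlub : ∀ y, 0 ≤ y → (∀ k, f k ≤ y) → x ≤ y) :
    b.opTrace x = ⨆ k, b.opTrace (f k) := by
  simp only [opTrace, ENNReal.tsum_eq_iSup_sum, ofReal_re_inner_isLUB hf h0 hx hlub]
  rw [iSup_comm]
  refine iSup_congr fun s => ?_
  exact ENNReal.finsetSum_iSup_of_monotone fun i k l hkl =>
    ENNReal.ofReal_le_ofReal (re_inner_le_of_le (hf hkl) (b i))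

/-! ### Finite-rank approximation from below: Bessel bounds the sums, Parseval identifies their
supremum. -/

/-- The compression `∑ i ∈ s, |t* b i⟩⟨t* b i|` of `t* t`. -/
noncomputable def HilbertBasis.partialSum (t : H →L[ℂ] H) (s : Finset ι) : H →L[ℂ] H :=
  ∑ i ∈ s, rankOne ℂ ((star t) (b i)) ((star t) (b i))

theorem HilbertBasis.partialSum_nonneg (t : H →L[ℂ] H) (s : Finset ι) : 0 ≤ b.partialSum t s :=
  Finset.sum_nonneg fun _ _ => rankOne_self_nonneg _

theorem HilbertBasis.partialSum_mono (t : H →L[ℂ] H) : Monotone (b.partialSum t) :=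
  fun _ _ h => Finset.sum_le_sum_of_subset_of_nonneg h fun _ _ _ => rankOne_self_nonneg _

theorem HilbertBasis.re_inner_partialSum (t : H →L[ℂ] H) (s : Finset ι) (v : H) :
    (inner ℂ v (b.partialSum t s v)).re = ∑ i ∈ s, ‖inner ℂ (b i) (t v)‖ ^ 2 := by
  rw [partialSum, sum_apply, inner_sum, Complex.re_sum]
  refine Finset.sum_congr rfl fun i _ => ?_
  have h : inner ℂ ((star t) (b i)) v = inner ℂ (b i) (t v) :=
    ContinuousLinearMap.adjoint_inner_left t v (b i)
  rw [inner_right_rankOne_apply, ← inner_conj_symm v, Complex.conj_mul', h]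
  rw [← Complex.ofReal_pow, Complex.ofReal_re]

theorem HilbertBasis.partialSum_le (t : H →L[ℂ] H) (s : Finset ι) :
    b.partialSum t s ≤ star t * t := by
  refine le_of_re_inner_le (IsSelfAdjoint.of_nonneg (b.partialSum_nonneg t s))
    (IsSelfAdjoint.star_mul_self t) fun v => ?_
  rw [b.re_inner_partialSum, re_inner_star_mul_self]
  exact b.orthonormal.sum_inner_products_le (t v)

theorem HilbertBasis.le_of_partialSum_le (t : H →L[ℂ] H) {y : H →L[ℂ] H} (hy : 0 ≤ y)
    (h : ∀ s, b.partialSum t s ≤ y) : star t * t ≤ y := by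
  refine le_of_re_inner_le (IsSelfAdjoint.star_mul_self t) (IsSelfAdjoint.of_nonneg hy)
    fun v => ?_
  rw [re_inner_star_mul_self]
  refine le_of_tendsto (b.hasSum_norm_inner_sq (t v)) (Filter.Eventually.of_forall fun s => ?_)
  change ∑ i ∈ s, ‖inner ℂ (b i) (t v)‖ ^ 2 ≤ _
  rw [← b.re_inner_partialSum]
  exact re_inner_le_of_le (h s) v

end OperatorTrace

/-! ### The basic construction over the trivial subsystem. -/

namespace WStarSystem

open InnerProductSpace

variable {H : Type*} [NormedAddCommGroup H] [InnerProductSpace ℂ H] [CompleteSpace H]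
  (S : WStarSystem H)

theorem J_J (x : H) : S.J (S.J x) = x := by
  have h : (fun x => S.J (S.J x)) = id := by
    refine Continuous.ext_on S.cyclic (S.J.continuous.comp S.J.continuous) continuous_id ?_
    rintro _ ⟨a, ha, rfl⟩
    have h1 := S.J_apply ⟨a, ha⟩
    have h2 := S.J_apply (star ⟨a, ha⟩)
    simp only [StarMemClass.coe_star, star_star] at h1 h2
    change S.J (S.J (a S.Ω)) = a S.Ω
    rw [h1, h2]
  exact congrFun h x

theorem rmul_algebraMap (x : H) (c : ℂ) : S.rmul x (algebraMap ℂ (H →L[ℂ] H) c) = c • x := by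
  have h : star (algebraMap ℂ (H →L[ℂ] H) c) = starRingEnd ℂ c • (1 : H →L[ℂ] H) := by
    rw [Algebra.algebraMap_eq_smul_one, star_smul, star_one]
    rfl
  rw [rmul, h, smul_apply, one_apply_eq_self, map_smulₛₗ, J_J]
  simp

theorem U_Ω : S.U S.Ω = S.Ω := by
  simpa using S.U_apply 1

/-- The definition of a system allows `Ω = 0`; by cyclicity this happens only on the zero space, and
the lemma disposes of that case below. -/
theorem eq_zero_of_Ω_eq_zero (h : S.Ω = 0) (v : H) : v = 0 := by
  have h1 : {x : H | ∃ a ∈ S.alg, a S.Ω = x} ⊆ {0} := by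
    rintro _ ⟨a, -, rfl⟩
    simp [h]
  exact closure_minimal h1 isClosed_singleton (S.cyclic v)

theorem mem_trivialSubsystem_alg {f : H →L[ℂ] H} :
    f ∈ S.trivialSubsystem.alg ↔ ∃ c : ℂ, algebraMap ℂ (H →L[ℂ] H) c = f :=
  StarSubalgebra.mem_bot

theorem trivialSubsystem_HF : S.trivialSubsystem.HF.toSubmodule = ℂ ∙ S.Ω := by
  have h : Submodule.span ℂ {x : H | ∃ f ∈ S.trivialSubsystem.alg, f S.Ω = x} = ℂ ∙ S.Ω := by
    apply le_antisymm
    · rw [Submodule.span_le]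
      rintro _ ⟨f, hf, rfl⟩
      obtain ⟨c, rfl⟩ := S.mem_trivialSubsystem_alg.mp hf
      exact Submodule.mem_span_singleton.mpr ⟨c, by simp [Algebra.algebraMap_eq_smul_one]⟩
    · rw [Submodule.span_singleton_le_iff_mem]
      exact Submodule.subset_span ⟨1, one_mem S.trivialSubsystem.alg, rfl⟩
  rw [Subsystem.HF, h]
  exact (Submodule.closed_of_finiteDimensional (ℂ ∙ S.Ω)).submodule_topologicalClosure_eq

theorem mem_trivialSubsystem_HF_orthogonal {x : H} :
    x ∈ S.trivialSubsystem.HFᗮ ↔ inner ℂ S.Ω x = 0 := by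
  change x ∈ S.trivialSubsystem.HF.toSubmoduleᗮ ↔ _
  rw [trivialSubsystem_HF, Submodule.mem_orthogonal_singleton_iff_inner_right]

theorem trivialSubsystem_e_apply (x : H) :
    S.trivialSubsystem.e x = (inner ℂ S.Ω x / ((‖S.Ω‖ ^ 2 : ℝ) : ℂ)) • S.Ω := by
  rw [Subsystem.e, starProjection_congr S.trivialSubsystem_HF, Submodule.starProjection_singleton]
  rfl

/-- By the bicommutant property it suffices that everything commuting with `A` and `e_F` is scalar.
-/
theorem mem_trivialSubsystem_basicConstruction (x : H →L[ℂ] H) :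
    x ∈ S.trivialSubsystem.basicConstruction := by
  intro M hM
  have hx : x ∈ Set.centralizer (Set.centralizer (M : Set (H →L[ℂ] H))) := by
    intro z hz
    have hA : ∀ a ∈ S.alg, a * z = z * a := fun a ha => hz a (hM (Or.inl ha))
    have he : S.trivialSubsystem.e * z = z * S.trivialSubsystem.e := hz _ (hM (Or.inr rfl))
    have heΩ : S.trivialSubsystem.e S.Ω = S.Ω := by
      rw [Subsystem.e, Submodule.starProjection_eq_self_iff, trivialSubsystem_HF]
      exact Submodule.mem_span_singleton_self _
    obtain ⟨c, hc⟩ : ∃ c : ℂ, z S.Ω = c • S.Ω := by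
      refine ⟨_, Eq.trans ?_ (S.trivialSubsystem_e_apply (z S.Ω))⟩
      have := congrArg (fun t : H →L[ℂ] H => t S.Ω) he
      simp only [mul_apply_eq_comp, heΩ] at this
      exact this.symm
    have hz' : z = algebraMap ℂ (H →L[ℂ] H) c := by
      refine ContinuousLinearMap.coeFn_injective (Continuous.ext_on S.cyclic z.continuous
        (ContinuousLinearMap.continuous _) ?_)
      rintro _ ⟨a, ha, rfl⟩
      have := congrArg (fun t : H →L[ℂ] H => t S.Ω) (hA a ha)
      simp only [mul_apply_eq_comp, hc, map_smul] at this
      simp [← this, Algebra.algebraMap_eq_smul_one]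
    rw [hz']
    exact Algebra.commutes c x
  rwa [M.centralizer_centralizer] at hx

/-- A positive operator as an element of the positive part of the basic construction. -/
def basicPosOf (x : H →L[ℂ] H) (hx : 0 ≤ x) : S.trivialSubsystem.basicPos :=
  ⟨x, S.mem_trivialSubsystem_basicConstruction x, hx⟩

theorem isContractiveFamily_trivialSubsystem_iff {n : ℕ} (ξ : Fin n → H) :
    S.trivialSubsystem.IsContractiveFamily ξ ↔
      ∀ c : Fin n → ℂ, ‖∑ i, c i • ξ i‖ ^ 2 ≤ (∑ i, ‖c i‖ ^ 2) * ‖S.Ω‖ ^ 2 := by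
  have key : ∀ c : Fin n → ℂ,
      (‖∑ i, S.rmul (ξ i) (algebraMap ℂ (H →L[ℂ] H) (c i))‖ ^ 2
        ≤ ∑ i, ‖(algebraMap ℂ (H →L[ℂ] H) (c i)) S.Ω‖ ^ 2) ↔
      ‖∑ i, c i • ξ i‖ ^ 2 ≤ (∑ i, ‖c i‖ ^ 2) * ‖S.Ω‖ ^ 2 := by
    intro c
    simp only [rmul_algebraMap]
    simp only [Algebra.algebraMap_eq_smul_one, smul_apply, one_apply_eq_self, norm_smul, mul_pow,
      Finset.sum_mul]
  constructor
  · intro h c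
    exact (key c).mp (h _ fun i => S.mem_trivialSubsystem_alg.mpr ⟨c i, rfl⟩)
  · intro h f hf
    choose c hc using fun i => S.mem_trivialSubsystem_alg.mp (hf i)
    obtain rfl : (fun i => algebraMap ℂ (H →L[ℂ] H) (c i)) = f := funext hc
    exact (key c).mpr (h c)

/-- The map `c ↦ ∑ cᵢ ξᵢ` has norm at most `‖Ω‖`; this is the same bound for its adjoint. -/
theorem sum_enorm_inner_sq_le {n : ℕ} {ξ : Fin n → H}
    (hξ : S.trivialSubsystem.IsContractiveFamily ξ) (v : H) :
    ∑ i, ‖inner ℂ v (ξ i)‖ₑ ^ 2 ≤ ‖S.Ω‖ₑ ^ 2 * ‖v‖ₑ ^ 2 := by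
  rw [isContractiveFamily_trivialSubsystem_iff] at hξ
  -- These coefficients make `⟪v, w⟫` equal to the sum `s` to be bounded; Cauchy–Schwarz with `‖w‖²
  -- ≤ s ‖Ω‖²` then allows cancelling one factor `s`.
  have h1 := hξ fun i => starRingEnd ℂ (inner ℂ v (ξ i))
  set w := ∑ i, starRingEnd ℂ (inner ℂ v (ξ i)) • ξ i with hw
  have h2 : inner ℂ v w = ((∑ i, ‖inner ℂ v (ξ i)‖ ^ 2 : ℝ) : ℂ) := by
    rw [hw, inner_sum, Complex.ofReal_sum]
    refine Finset.sum_congr rfl fun i _ => ?_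
    rw [inner_smul_right, Complex.conj_mul', Complex.ofReal_pow]
  simp only [RCLike.norm_conj] at h1
  set s : ℝ := ∑ i, ‖inner ℂ v (ξ i)‖ ^ 2 with hs
  have hs0 : 0 ≤ s := Finset.sum_nonneg fun i _ => sq_nonneg _
  have h3 : s ≤ ‖v‖ * ‖w‖ := by
    have := norm_inner_le_norm (𝕜 := ℂ) v w
    rwa [h2, Complex.norm_real, Real.norm_of_nonneg hs0] at this
  have h4 : s ≤ ‖S.Ω‖ ^ 2 * ‖v‖ ^ 2 := by
    rcases hs0.eq_or_lt with h0 | h0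
    · rw [← h0]; positivity
    · have h5 : s * s ≤ s * (‖S.Ω‖ ^ 2 * ‖v‖ ^ 2) := by
        calc s * s ≤ (‖v‖ * ‖w‖) * (‖v‖ * ‖w‖) := by gcongr
          _ = ‖v‖ ^ 2 * ‖w‖ ^ 2 := by ring
          _ ≤ ‖v‖ ^ 2 * (s * ‖S.Ω‖ ^ 2) := by gcongr
          _ = _ := by ring
      exact le_of_mul_le_mul_left h5 h0
  have h6 := ENNReal.ofReal_le_ofReal h4
  rw [hs, ENNReal.ofReal_sum_of_nonneg fun i _ => sq_nonneg _,
    ENNReal.ofReal_mul (sq_nonneg _)] at h6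
  simpa only [ENNReal.ofReal_pow (norm_nonneg _), ofReal_norm] using h6

/-- An orthonormal family scaled by `‖Ω‖` is contractive, so it competes in the supremum. -/
theorem le_basicTrace_of_orthonormal {n : ℕ} {v : Fin n → H} (hv : Orthonormal ℂ v)
    (x : S.trivialSubsystem.basicPos) :
    ‖S.Ω‖ₑ ^ 2 * ∑ i, ENNReal.ofReal (inner ℂ (v i) (x.1 (v i))).re
      ≤ S.trivialSubsystem.basicTrace x := by
  have hξ : S.trivialSubsystem.IsContractiveFamily fun i => (‖S.Ω‖ : ℂ) • v i := by
    rw [isContractiveFamily_trivialSubsystem_iff]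
    intro c
    have h1 : ∑ i, c i • (‖S.Ω‖ : ℂ) • v i = (‖S.Ω‖ : ℂ) • ∑ i, c i • v i := by
      rw [Finset.smul_sum]
      exact Finset.sum_congr rfl fun i _ => smul_comm _ _ _
    have h2 : ‖∑ i, c i • v i‖ ^ 2 = ∑ i, ‖c i‖ ^ 2 := by
      have h3 := hv.inner_sum c c Finset.univ
      rw [inner_self_eq_norm_sq_to_K] at h3
      simp only [Complex.conj_mul'] at h3
      refine Complex.ofReal_injective ?_
      push_cast
      exact h3
    rw [h1, norm_smul, mul_pow, h2, Complex.norm_real, norm_norm, mul_comm]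
  refine le_trans (le_of_eq ?_) (le_iSup_of_le n (le_iSup_of_le _ (le_iSup_of_le hξ le_rfl)))
  rw [Finset.mul_sum]
  refine Finset.sum_congr rfl fun i _ => ?_
  have h : (inner ℂ ((‖S.Ω‖ : ℂ) • v i) (x.1 ((‖S.Ω‖ : ℂ) • v i))).re
      = ‖S.Ω‖ ^ 2 * (inner ℂ (v i) (x.1 (v i))).re := by
    rw [map_smul, inner_smul_left, inner_smul_right, Complex.conj_ofReal, ← mul_assoc,
      ← Complex.ofReal_mul, Complex.re_ofReal_mul, sq]
  rw [h, ENNReal.ofReal_mul (sq_nonneg _), ENNReal.ofReal_pow (norm_nonneg _), ofReal_norm]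

/-! ### The weight as a multiple of the trace. -/

variable {ι : Type*} (b : HilbertBasis ι ℂ H)

theorem basicTrace_eq_opTrace (x : S.trivialSubsystem.basicPos) :
    S.trivialSubsystem.basicTrace x = ‖S.Ω‖ₑ ^ 2 * b.opTrace x.1 := by
  apply le_antisymm
  · refine iSup_le fun n => iSup_le fun ξ => iSup_le fun hξ => ?_
    obtain ⟨s, hs⟩ := exists_eq_star_mul_self x.2.2
    rw [hs]
    simp_rw [ofReal_re_inner_star_mul_self]
    rw [b.opTrace_star_mul_self, ← b.tsum_enorm_star_apply_sq, ← ENNReal.tsum_mul_left]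
    -- Expanding each `‖s ξᵢ‖²` in the basis and summing over `i` first leaves, for each `j`, the
    -- adjoint bound at the vector `s* b j`.
    simp_rw [← b.tsum_enorm_inner_sq (s _)]
    rw [← Summable.tsum_finsetSum fun _ _ => ENNReal.summable]
    refine ENNReal.tsum_le_tsum fun j => le_trans (le_of_eq ?_) (S.sum_enorm_inner_sq_le hξ _)
    refine Finset.sum_congr rfl fun i _ => ?_
    have h : inner ℂ ((star s) (b j)) (ξ i) = inner ℂ (b j) (s (ξ i)) :=
      ContinuousLinearMap.adjoint_inner_left s (ξ i) (b j)
    rw [h]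
  · rw [HilbertBasis.opTrace, ENNReal.tsum_eq_iSup_sum, ENNReal.mul_iSup]
    refine iSup_le fun s => ?_
    have h := S.le_basicTrace_of_orthonormal
      (b.orthonormal.comp (fun i : Fin s.card => (s.equivFin.symm i : ι))
        (Subtype.val_injective.comp s.equivFin.symm.injective)) x
    refine le_trans (le_of_eq ?_) h
    congr 1
    rw [← Finset.sum_coe_sort]
    exact (Equiv.sum_comp s.equivFin.symm fun i : s =>
      ENNReal.ofReal (inner ℂ (b i) (x.1 (b i))).re).symm

theorem trivialSubsystem_e_eq_rankOne :
    S.trivialSubsystem.e = rankOne ℂ ((‖S.Ω‖⁻¹ : ℂ) • S.Ω) ((‖S.Ω‖⁻¹ : ℂ) • S.Ω) := by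
  rw [Subsystem.e, starProjection_congr S.trivialSubsystem_HF,
    starProjection_span_singleton_eq_rankOne]

theorem isBasicTrace_basicTrace :
    S.trivialSubsystem.IsBasicTrace S.trivialSubsystem.basicTrace := by
  obtain ⟨_, b, -⟩ := exists_hilbertBasis ℂ H
  refine ⟨?_, ?_, ?_, ?_, ?_, ?_, ?_⟩
  · intro x y z h
    simp only [S.basicTrace_eq_opTrace b, h, b.opTrace_add x.2.2 y.2.2, mul_add]
  · intro c x y h
    simp only [S.basicTrace_eq_opTrace b, h, b.opTrace_smul, mul_left_comm]
  · intro t _ x y hx hy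
    simp only [S.basicTrace_eq_opTrace b, hx, hy, b.opTrace_mul_comm_star]
  · intro x hx
    rw [S.basicTrace_eq_opTrace b, mul_eq_zero] at hx
    rcases hx with h | h
    · ext v
      exact (S.eq_zero_of_Ω_eq_zero (by simpa using h) _).trans
        (S.eq_zero_of_Ω_eq_zero (by simpa using h) _).symm
    · exact b.eq_zero_of_opTrace_eq_zero x.2.2 h
  · intro D x hne hD hx
    have : Nonempty D := hne.to_subtype
    have : IsDirectedOrder D := directedOn_iff_isDirectedOrder.mp hD
    simp only [S.basicTrace_eq_opTrace b]
    rw [b.opTrace_isLUB (f := fun d : D => d.1.1) (fun d d' h => h) (fun d => d.1.2.2)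
      (fun d => hx.1 d.2) (fun y hy h =>
        (isLUB_le_iff hx (b := S.basicPosOf y hy)).mpr fun d hd => h ⟨d, hd⟩),
      ENNReal.mul_iSup, iSup_subtype']
  · intro x hx
    obtain ⟨s, hs⟩ := exists_eq_star_mul_self x.2.2
    obtain ⟨i, hi⟩ : ∃ i, (star s) (b i) ≠ 0 := by
      by_contra! h
      refine hx (b.eq_zero_of_opTrace_eq_zero x.2.2 ?_)
      rw [hs, b.opTrace_star_mul_self, ← b.tsum_enorm_star_apply_sq]
      simp [h]
    -- A single nonzero term of the approximation of `s* s` lies below `x` and has finite trace.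
    refine ⟨S.basicPosOf _ (rankOne_self_nonneg ((star s) (b i))), ?_, ?_, ?_⟩
    · have h := b.partialSum_le s {i}
      rw [HilbertBasis.partialSum, Finset.sum_singleton, ← hs] at h
      exact h
    · exact rankOne_ne_zero hi hi
    · rw [S.basicTrace_eq_opTrace b, basicPosOf, b.opTrace_rankOne]
      exact ENNReal.mul_lt_top (by simp) (by simp)
  · intro a ha x hx
    -- The normalization of `Ω` in `e_F` cancels the factor `‖Ω‖²` of the weight; traciality of `μ`
    -- then replaces `‖a* Ω‖²` by `μ(a* a)`.
    have h1 : x.1 = rankOne ℂ ((‖S.Ω‖⁻¹ : ℂ) • (star a) S.Ω) ((‖S.Ω‖⁻¹ : ℂ) • (star a) S.Ω) := by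
      rw [hx, trivialSubsystem_e_eq_rankOne, mul_assoc, ← map_smul]
      change (star a) ∘L (_ ∘L a) = _
      rw [rankOne_comp, comp_rankOne]
      rfl
    have h2 : ENNReal.ofReal (inner ℂ S.Ω ((star a * a) S.Ω)).re = ‖(star a) S.Ω‖ₑ ^ 2 := by
      rw [S.tracial _ (star_mem ha) _ ha]
      have := ofReal_re_inner_star_mul_self (star a) S.Ω
      rwa [star_star] at this
    rw [S.basicTrace_eq_opTrace b, h1, b.opTrace_rankOne, h2, enorm_smul, mul_pow, ← mul_assoc,
      ← mul_pow]
    by_cases h0 : S.Ω = 0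
    · simp [h0]
    · have : ‖S.Ω‖ₑ * ‖(‖S.Ω‖⁻¹ : ℂ)‖ₑ = 1 := by
        have h3 : ‖((‖S.Ω‖ : ℝ) : ℂ)‖ₑ = ‖S.Ω‖ₑ := by
          rw [← ofReal_norm, Complex.norm_real, norm_norm, ofReal_norm]
        rw [← h3, ← enorm_mul, mul_inv_cancel₀ (by simpa using h0)]
        simp
      rw [this]
      simp

/-! ### Uniqueness of the weight. -/

variable {S}

/-- With `u = Ω/‖Ω‖` and `t = |v⟩⟨u|`, one has `t* t = ‖v‖² e_F` and `t t* = |v⟩⟨v|`, so traciality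
and homogeneity reduce to `e_F`, whose value comes from `a = 1`. -/
theorem Subsystem.IsBasicTrace.apply_rankOne {τ : S.trivialSubsystem.basicPos → ℝ≥0∞}
    (hτ : S.trivialSubsystem.IsBasicTrace τ) (v : H) :
    τ (S.basicPosOf _ (rankOne_self_nonneg v)) = ‖S.Ω‖ₑ ^ 2 * ‖v‖ₑ ^ 2 := by
  have he0 : 0 ≤ S.trivialSubsystem.e := by
    rw [trivialSubsystem_e_eq_rankOne]
    exact rankOne_self_nonneg _
  have he := hτ.apply_e 1 (one_mem _) (S.basicPosOf _ he0) (by simp [basicPosOf])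
  rw [ofReal_re_inner_star_mul_self, one_apply_eq_self] at he
  by_cases h0 : S.Ω = 0
  · have hv := S.eq_zero_of_Ω_eq_zero h0 v
    have h := hτ.smul 0 (S.basicPosOf _ (rankOne_self_nonneg v))
      (S.basicPosOf _ (rankOne_self_nonneg v)) (by simp [basicPosOf, hv])
    rw [h]
    simp [h0]
  · set u : H := (‖S.Ω‖⁻¹ : ℂ) • S.Ω with hu
    have hu1 : ‖u‖ = 1 := by
      rw [hu, norm_smul]
      simp [h0]
    have hstar : star (rankOne ℂ v u) = rankOne ℂ u v := adjoint_rankOne v u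
    have h1 : star (rankOne ℂ v u) * rankOne ℂ v u = ((‖v‖₊ ^ 2 : ℝ≥0) : ℝ) •
        S.trivialSubsystem.e := by
      rw [hstar, trivialSubsystem_e_eq_rankOne, ← hu]
      change rankOne ℂ u v ∘L rankOne ℂ v u = _
      rw [rankOne_comp_rankOne, inner_self_eq_norm_sq_to_K]
      ext x
      simp [← Complex.coe_smul]
    have h2 : rankOne ℂ v v = rankOne ℂ v u * star (rankOne ℂ v u) := by
      rw [hstar]
      change _ = rankOne ℂ v u ∘L rankOne ℂ u v
      rw [rankOne_comp_rankOne, inner_self_eq_norm_sq_to_K, hu1]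
      simp
    have h3 := hτ.tracial (rankOne ℂ v u) (S.mem_trivialSubsystem_basicConstruction _)
      (S.basicPosOf _ (star_mul_self_nonneg (rankOne ℂ v u)))
      (S.basicPosOf _ (rankOne_self_nonneg v)) rfl h2
    rw [← h3, hτ.smul (‖v‖₊ ^ 2) (S.basicPosOf _ he0) _ h1, he, mul_comm]
    simp [enorm]

theorem Subsystem.IsBasicTrace.eq_basicTrace {τ : S.trivialSubsystem.basicPos → ℝ≥0∞}
    (hτ : S.trivialSubsystem.IsBasicTrace τ) : τ = S.trivialSubsystem.basicTrace := by
  obtain ⟨_, b, -⟩ := exists_hilbertBasis ℂ H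
  funext x
  obtain ⟨t, ht⟩ := exists_eq_star_mul_self x.2.2
  have h0 : τ (S.basicPosOf 0 le_rfl) = 0 := by
    have h := hτ.smul 0 (S.basicPosOf 0 le_rfl) (S.basicPosOf 0 le_rfl) (by simp [basicPosOf])
    simpa using h
  have hsum : ∀ s, τ (S.basicPosOf _ (b.partialSum_nonneg t s))
      = ∑ i ∈ s, ‖S.Ω‖ₑ ^ 2 * ‖(star t) (b i)‖ₑ ^ 2 := by
    classical
    intro s
    induction s using Finset.induction_on with
    | empty => exact h0
    | insert i s hi ih =>
      rw [Finset.sum_insert hi, ← ih, ← hτ.apply_rankOne]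
      exact hτ.add _ _ _ (Finset.sum_insert hi)
  -- Normality along the finite partial sums of `t* t`, on which additivity already fixes `τ`.
  have hn := hτ.normal (Set.range fun s => S.basicPosOf _ (b.partialSum_nonneg t s)) x
    (Set.range_nonempty _) ?_ ?_
  · rw [hn, iSup_range, S.basicTrace_eq_opTrace b, ht, b.opTrace_star_mul_self,
      ← b.tsum_enorm_star_apply_sq, ← ENNReal.tsum_mul_left, ENNReal.tsum_eq_iSup_sum]
    exact iSup_congr hsum
  · rw [directedOn_range]
    exact Monotone.directed_le fun s s' h => b.partialSum_mono t h
  · constructor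
    · rintro _ ⟨s, rfl⟩
      change b.partialSum t s ≤ x.1
      rw [ht]
      exact b.partialSum_le t s
    · intro y hy
      change x.1 ≤ y.1
      rw [ht]
      exact b.le_of_partialSum_le t y.2.2 fun s => hy ⟨s, rfl⟩

end WStarSystem

/-! ### Modules over the trivial subsystem and eigenvectors of `U`. -/

namespace WStarSystem

open InnerProductSpace

variable {H : Type*} [NormedAddCommGroup H] [InnerProductSpace ℂ H]

/-- A finite-dimensional subspace invariant under a linear isometry is spanned by eigenvectors. -/
theorem le_span_eigenvectors (U : H →ₗᵢ[ℂ] H) (V : Submodule ℂ H) [FiniteDimensional ℂ V]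
    (hV : ∀ x ∈ V, U x ∈ V) : V ≤ Submodule.span ℂ {x : H | x ≠ 0 ∧ ∃ c : ℂ, U x = c • x} := by
  set s : Set H := {x : H | x ∈ V ∧ x ≠ 0 ∧ ∃ c : ℂ, U x = c • x} with hs
  set E : Submodule ℂ H := Submodule.span ℂ s with hE
  have hEV : E ≤ V := Submodule.span_le.mpr fun x hx => hx.1
  have : FiniteDimensional ℂ E := Submodule.finiteDimensional_of_le hEV
  -- An isometry preserves inner products and its eigenvalues are nonzero, so the complement of the
  -- eigenvector span is invariant too.
  have hUW : ∀ y ∈ Eᗮ ⊓ V, U y ∈ Eᗮ ⊓ V := by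
    rintro y ⟨hyE, hyV⟩
    refine ⟨?_, hV y hyV⟩
    have h : E ≤ (ℂ ∙ U y)ᗮ := by
      refine Submodule.span_le.mpr fun x hx => ?_
      obtain ⟨c, hc⟩ := hx.2.2
      have hc0 : c ≠ 0 := by
        rintro rfl
        rw [zero_smul] at hc
        exact hx.2.1 (U.injective (hc.trans U.map_zero.symm))
      have h1 : inner ℂ (U x) (U y) = 0 := by
        rw [U.inner_map_map]
        exact hyE x (Submodule.subset_span hx)
      rw [hc, inner_smul_left, mul_eq_zero] at h1
      have h2 := h1.resolve_left (by simpa using hc0)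
      exact Submodule.mem_orthogonal_singleton_iff_inner_left.mpr h2
    intro x hx
    exact Submodule.mem_orthogonal_singleton_iff_inner_left.mp (h hx)
  -- Otherwise the complement would contain an eigenvector, which lies in `E` as well and is thus
  -- orthogonal to itself.
  have hbot : Eᗮ ⊓ V = ⊥ := by
    by_contra hne
    have : Nontrivial ↥(Eᗮ ⊓ V) := Submodule.nontrivial_iff_ne_bot.mpr hne
    have : FiniteDimensional ℂ ↥(Eᗮ ⊓ V) := Submodule.finiteDimensional_of_le inf_le_right
    obtain ⟨c, hc⟩ := Module.End.exists_eigenvalue (K := ℂ) (U.toLinearMap.restrict hUW)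
    obtain ⟨x, hx⟩ := hc.exists_hasEigenvector
    have hx0 : (x : H) ≠ 0 := fun h => hx.2 (Subtype.ext h)
    have hxc : U x = c • (x : H) := congrArg Subtype.val hx.apply_eq_smul
    have hxE : (x : H) ∈ E := Submodule.subset_span ⟨x.2.2, hx0, c, hxc⟩
    exact hx0 (inner_self_eq_zero.mp (x.2.1 x hxE))
  rw [← Submodule.sup_orthogonal_inf_of_hasOrthogonalProjection hEV, hbot, sup_bot_eq]
  exact Submodule.span_mono fun x hx => hx.2

variable [CompleteSpace H] {S : WStarSystem H}

/-- Any `n` orthonormal vectors in `V` force the weight of `P_V` to be at least `n ‖Ω‖²`, so finite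
weight excludes an infinite basis. -/
theorem Subsystem.IsUModule.finiteDimensional {V : ClosedSubmodule ℂ H}
    (hV : S.trivialSubsystem.IsUModule V) : FiniteDimensional ℂ V.toSubmodule := by
  by_cases h0 : S.Ω = 0
  · have : Subsingleton H := ⟨fun x y =>
      (S.eq_zero_of_Ω_eq_zero h0 x).trans (S.eq_zero_of_Ω_eq_zero h0 y).symm⟩
    infer_instance
  have : CompleteSpace V.toSubmodule := V.isClosed.completeSpace_coe
  obtain ⟨w, b, -⟩ := exists_hilbertBasis ℂ V.toSubmodule
  obtain ⟨h, hfin⟩ := hV.finite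
  have hw : Finite w := by
    by_contra hinf
    rw [not_finite_iff_infinite] at hinf
    obtain ⟨n, hn⟩ := ENNReal.exists_nat_mul_gt (a := ‖S.Ω‖ₑ ^ 2) (by simpa using h0) hfin.ne
    refine absurd hn (not_lt.mpr ?_)
    have hv : Orthonormal ℂ fun i : Fin n => (b (Infinite.natEmbedding w i) : H) :=
      (b.orthonormal.comp (fun i : Fin n => Infinite.natEmbedding w i)
        ((Infinite.natEmbedding w).injective.comp Fin.val_injective)).comp_linearIsometry
          V.toSubmodule.subtypeₗᵢ
    refine le_trans (le_of_eq ?_) (S.le_basicTrace_of_orthonormal hv ⟨_, h⟩)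
    have h1 : ∀ i : Fin n, ENNReal.ofReal (inner ℂ (b (Infinite.natEmbedding w i) : H)
        (V.toSubmodule.starProjection (b (Infinite.natEmbedding w i) : H))).re = 1 := by
      intro i
      rw [Submodule.starProjection_eq_self_iff.mpr (b (Infinite.natEmbedding w i)).2]
      have h2 := hv.1 i
      rw [inner_self_eq_norm_sq_to_K, h2]
      simp
    rw [Finset.sum_congr rfl fun i _ => h1 i]
    simp [mul_comm]
  have := Fintype.ofFinite w
  exact b.toOrthonormalBasis.toBasis.finiteDimensional_of_finite

theorem Subsystem.IsUModule.le_span_eigenvectors {V : ClosedSubmodule ℂ H}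
    (hV : S.trivialSubsystem.IsUModule V) :
    V.toSubmodule ≤ Submodule.span ℂ {x : H | x ≠ 0 ∧ ∃ c : ℂ, S.U x = c • x} := by
  have := hV.finiteDimensional
  refine WStarSystem.le_span_eigenvectors S.U.toLinearIsometry V.toSubmodule fun x hx => ?_
  have h : S.U x ∈ (V : Set H) := hV.map_eq ▸ Set.mem_image_of_mem _ hx
  exact h

theorem isUModule_span_singleton {y : H} {c : ℂ} (hy : inner ℂ S.Ω y = 0) (hy0 : y ≠ 0)
    (hc : S.U y = c • y) :
    S.trivialSubsystem.IsUModule ⟨ℂ ∙ y, Submodule.closed_of_finiteDimensional _⟩ := by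
  have hc0 : c ≠ 0 := by
    rintro rfl
    rw [zero_smul] at hc
    exact hy0 (S.U.injective (hc.trans S.U.map_zero.symm))
  refine ⟨?_, ?_, ?_, ?_⟩
  · intro x hx
    obtain ⟨k, rfl⟩ := Submodule.mem_span_singleton.mp hx
    rw [mem_trivialSubsystem_HF_orthogonal, inner_smul_right, hy, mul_zero]
  · ext x
    constructor
    · rintro ⟨z, hz, rfl⟩
      obtain ⟨k, rfl⟩ := Submodule.mem_span_singleton.mp hz
      exact Submodule.mem_span_singleton.mpr ⟨k * c, by rw [map_smul, hc, smul_smul]⟩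
    · intro hx
      obtain ⟨k, rfl⟩ := Submodule.mem_span_singleton.mp hx
      refine ⟨(k * c⁻¹) • y, Submodule.mem_span_singleton.mpr ⟨_, rfl⟩, ?_⟩
      rw [map_smul, hc, smul_smul, inv_mul_cancel_right₀ hc0]
  · intro x hx f hf
    obtain ⟨k, rfl⟩ := S.mem_trivialSubsystem_alg.mp hf
    rw [rmul_algebraMap]
    exact Submodule.smul_mem _ k hx
  · have h0 : (0 : H →L[ℂ] H) ≤ (ℂ ∙ y).starProjection := by
      rw [starProjection_span_singleton_eq_rankOne]
      exact rankOne_self_nonneg _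
    refine ⟨⟨S.mem_trivialSubsystem_basicConstruction _, h0⟩, ?_⟩
    obtain ⟨_, b, -⟩ := exists_hilbertBasis ℂ H
    rw [S.basicTrace_eq_opTrace b]
    change _ * b.opTrace (ℂ ∙ y).starProjection < _
    rw [starProjection_span_singleton_eq_rankOne, b.opTrace_rankOne]
    exact ENNReal.mul_lt_top (by simp) (by simp)

/-! ### Comparison of the two notions of discrete spectrum. -/

variable (S)

theorem moduleSpan_trivialSubsystem_le :
    S.trivialSubsystem.moduleSpan ≤ S.trivialSubsystem.HFᗮ := by
  rw [Subsystem.moduleSpan, Submodule.closure_le, Submodule.span_le]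
  rintro x ⟨V, hV, hx⟩
  exact hV.le_orthogonal hx

theorem sub_e_apply_mem (x : H) : x - S.trivialSubsystem.e x ∈ S.trivialSubsystem.HFᗮ :=
  Submodule.sub_starProjection_mem_orthogonal x

/-- As `U` fixes `Ω`, it preserves `Ωᗮ`; hence the component of an eigenvector orthogonal to `Ω` is
zero or an eigenvector for the same `c`. -/
theorem sub_e_apply_mem_moduleSpan {x : H} {c : ℂ} (hx : S.U x = c • x) :
    x - S.trivialSubsystem.e x ∈ S.trivialSubsystem.moduleSpan := by
  set y := x - S.trivialSubsystem.e x with hy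
  have hyΩ : inner ℂ S.Ω y = 0 := S.mem_trivialSubsystem_HF_orthogonal.mp (S.sub_e_apply_mem x)
  obtain ⟨k, hk⟩ : ∃ k : ℂ, S.trivialSubsystem.e x = k • S.Ω := ⟨_, S.trivialSubsystem_e_apply x⟩
  have hUyΩ : inner ℂ S.Ω (S.U y) = 0 := by
    rw [← hyΩ, ← S.U.inner_map_map S.Ω y, U_Ω]
  have h1 : S.U y = c • y + ((c - 1) * k) • S.Ω := by
    rw [hy, map_sub, hx, hk, map_smul, U_Ω]
    module
  have hz : ((c - 1) * k) • S.Ω = 0 := by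
    have h2 := hUyΩ
    rw [h1, inner_add_right, inner_smul_right, hyΩ, mul_zero, zero_add] at h2
    rw [← inner_self_eq_zero (𝕜 := ℂ), inner_smul_left, h2, mul_zero]
  rw [hz, add_zero] at h1
  by_cases hy0 : y = 0
  · rw [hy0]
    exact zero_mem _
  · exact Submodule.le_topologicalClosure _ (Submodule.subset_span
      ⟨_, isUModule_span_singleton hyΩ hy0 h1, Submodule.mem_span_singleton_self y⟩)

theorem hasDiscreteSpectrumRel_trivialSubsystem_iff :
    S.HasDiscreteSpectrumRel S.trivialSubsystem ↔ S.HasDiscreteSpectrum := by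
  constructor
  · intro h
    have h1 : S.trivialSubsystem.moduleSpan
        ≤ (Submodule.span ℂ {x : H | x ≠ 0 ∧ ∃ c : ℂ, S.U x = c • x}).closure := by
      rw [Subsystem.moduleSpan, Submodule.closure_le, Submodule.span_le]
      rintro x ⟨V, hV, hx⟩
      exact Submodule.le_topologicalClosure _ (hV.le_span_eigenvectors hx)
    have hΩ : S.Ω ∈ (Submodule.span ℂ {x : H | x ≠ 0 ∧ ∃ c : ℂ, S.U x = c • x}).closure := by
      by_cases h0 : S.Ω = 0
      · rw [h0]
        exact zero_mem _
      · exact Submodule.le_topologicalClosure _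
          (Submodule.subset_span ⟨h0, 1, by rw [U_Ω, one_smul]⟩)
    refine top_unique fun x _ => ?_
    have h2 := h1 (h.ge (S.sub_e_apply_mem x))
    rw [trivialSubsystem_e_apply] at h2
    have h3 := add_mem h2 (Submodule.smul_mem _ (inner ℂ S.Ω x / ((‖S.Ω‖ ^ 2 : ℝ) : ℂ)) hΩ)
    rwa [sub_add_cancel] at h3
  · intro h
    refine le_antisymm S.moduleSpan_trivialSubsystem_le fun x hx => ?_
    -- The preimage of a closed subspace under the bounded map `1 - e_F` is closed, so only
    -- eigenvectors need checking.
    have h1 : (Submodule.span ℂ {x : H | x ≠ 0 ∧ ∃ c : ℂ, S.U x = c • x}).closure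
        ≤ S.trivialSubsystem.moduleSpan.comap (1 - S.trivialSubsystem.e) := by
      rw [Submodule.closure_le, Submodule.span_le]
      rintro x ⟨-, c, hc⟩
      exact S.sub_e_apply_mem_moduleSpan hc
    have h2 : x - S.trivialSubsystem.e x ∈ S.trivialSubsystem.moduleSpan :=
      h1 (h.ge (ClosedSubmodule.mem_top (x := x)))
    rwa [trivialSubsystem_e_apply, S.mem_trivialSubsystem_HF_orthogonal.mp hx, zero_div, zero_smul,
      sub_zero] at h2

end WStarSystem

theorem mainTheorem7 {H : Type*} [NormedAddCommGroup H] [InnerProductSpace ℂ H]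
    [CompleteSpace H] (S : WStarSystem H) :
    (∀ τ : S.trivialSubsystem.basicPos → ℝ≥0∞,
      S.trivialSubsystem.IsBasicTrace τ ↔ τ = S.trivialSubsystem.basicTrace) ∧
    (S.HasDiscreteSpectrumRel S.trivialSubsystem ↔ S.HasDiscreteSpectrum) :=
  ⟨fun _ => ⟨fun h => h.eq_basicTrace, fun h => h ▸ S.isBasicTrace_basicTrace⟩,
    S.hasDiscreteSpectrumRel_trivialSubsystem_iff⟩
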